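/- Consider the following synchronous message-passing (CONGEST) model. The network is a finite simple graph $G=(V,E)$ with $n=|V|$ vertices and positive real edge weights $w:E\to(0,\infty)$; it is also the input graph. The vertices carry distinct identifiers in $\{0,\dots,n^c-1\}$ for a fixed constant $c\in\mathbb N$, and the edges at each vertex are numbered arbitrarily (port numbers). Initially a vertex knows only $n$, its own identifier, and the weights of its incident edges (by port number). In each round every vertex sends one bit string along each incident edge, receives the strings sent to it by its neighbors, and updates its state; local computation is not restricted, and all vertices run the same deterministic code. For $k\ge 1$ and an assignment $X:V\to\{1,\dots,k\}$ let $\mathrm{cut}_w(X)=\sum_{uv\in E,\;X(u)\ne X(v)}w(uv)$, and let $\mathrm{OPT}_k(G,w)=\max_X \mathrm{cut}_w(X)$ be the optimal value of Weighted Max $k$-Cut. Let $\log^* n$ denote the least $i\ge 0$ such that applying $\log_2$ $i$ times to $n$ gives a value at most $1$. Theorem. For every real $\varepsilon>0$ and every $c\in\mathbb N$ there is a constant $C$ such that for every integer $k\ge 1$ there are a constant $B$ and a deterministic algorithm in this model with the following properties. On every network $(G,w)$ as above with $n$ vertices, whatever the identifiers and port numbers, it stops after at most $C\,(\log^* n+1)$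 rounds, every message has at most $B\,(\lfloor\log_2 n\rfloor+1)$ bits (for $n\geq 1$), and every vertex $v$ outputs a value $X(v)\in\{1,\dots,k\}$ such that $$\mathrm{cut}_w(X)\;\ge\;\Bigl(1-\frac1k-\varepsilon\Bigr)\,\mathrm{OPT}_k(G,w).$$ That is, for every constant $\varepsilon > 0$ there is a deterministic $(1-1/k-\varepsilon)$-approximation algorithm for Weighted Max $k$-Cut that runs in $O(\log^* n)$ rounds of the CONGEST model. -/

import Mathlib

noncomputable section

/-- The iterated logarithm `log* n`: the least number of applications of `log₂` that takes `n`
to a value at most `1`. -/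
def logStar (n : ℕ) : ℕ :=
  sInf {i : ℕ | (Real.logb 2)^[i] (n : ℝ) ≤ 1}

open Classical in
/-- The weight of the `k`-cut `X` (with parts `X ⁻¹' {a}`, possibly empty): the total weight of the
edges whose endpoints lie in different parts. Values of `w` outside the edge set are irrelevant. -/
def cutWeight {V : Type} [Fintype V] (G : SimpleGraph V) (w : Sym2 V → ℝ) {k : ℕ}
    (X : V → Fin k) : ℝ :=
  ∑ e ∈ G.edgeFinset with ¬ (e.map X).IsDiag, w e

/-- The optimal value of weighted Max `k`-Cut (a maximum over finitely many cuts). -/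
def maxKCut {V : Type} [Fintype V] (G : SimpleGraph V) (w : Sym2 V → ℝ) (k : ℕ) : ℝ :=
  ⨆ X : V → Fin k, cutWeight G w X

/-- A communication network that is also the weighted input graph. Vertices carry distinct
identifiers, and the edges at `v` are numbered by the ports `0, …, deg v - 1` of `v` in an arbitrary
way: `port v i` is the neighbor at the other end of port `i` of `v`. -/
structure Network (V : Type) where
  graph : SimpleGraph V
  weight : Sym2 V → ℝ
  weight_pos : ∀ e ∈ graph.edgeSet, 0 < weight e
  ident : V → ℕ
  ident_injective : Function.Injective ident
  port : ∀ v : V, Fin (Nat.card (graph.neighborSet v)) ≃ graph.neighborSet v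

/-- The degree of a vertex, that is, its number of ports. -/
abbrev Network.deg {V : Type} (N : Network V) (v : V) : ℕ :=
  Nat.card (N.graph.neighborSet v)

/-- A deterministic synchronous message-passing algorithm with unlimited local computation, with
outputs in `Out`. Every vertex runs the same code. `State d` is the set of internal states of a
vertex with `d` ports. A vertex initially knows the number `n` of vertices, its own identifier, and
the weight of the edge behind each of its ports. In every round it sends one bit string through each
of its ports, receives one bit string through each of its ports, and updates its state. On a network
with `n` vertices the algorithm stops after `rounds n` rounds, and the vertices then produce their
outputs. -/
structure DistAlgorithm (Out : Type) where
  State : ℕ → Type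
  init : ∀ {d : ℕ} (_n _ident : ℕ) (_weights : Fin d → ℝ), State d
  send : ∀ {d : ℕ}, State d → Fin d → List Bool
  receive : ∀ {d : ℕ}, State d → (Fin d → List Bool) → State d
  rounds : ℕ → ℕ
  output : ∀ {d : ℕ}, State d → Out

namespace DistAlgorithm

variable {Out V : Type} [Fintype V]

/-- The state of each vertex of `N` after `t` rounds. The string received by `v` through its port
`i`, behind which is the neighbor `u`, is the one sent by `u` through the port of `u` leading
to `v`. -/
def stateAfter (A : DistAlgorithm Out) (N : Network V) : ℕ → ∀ v : V, A.State (N.deg v)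
  | 0, v => A.init (Fintype.card V) (N.ident v) fun i => N.weight s(v, (N.port v i : V))
  | t + 1, v => A.receive (stateAfter A N t v) fun i =>
      A.send (stateAfter A N t (N.port v i))
        ((N.port (N.port v i)).symm ⟨v, SimpleGraph.Adj.symm (N.port v i).2⟩)

/-- The outputs of the vertices when the algorithm stops. -/
def result (A : DistAlgorithm Out) (N : Network V) (v : V) : Out :=
  A.output (A.stateAfter N (A.rounds (Fintype.card V)) v)

/-- Every message sent in the execution of `A` on `N` consists of at most `b` bits. -/
def MessagesBoundedBy (A : DistAlgorithm Out) (N : Network V) (b : ℕ) : Prop :=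
  ∀ t < A.rounds (Fintype.card V), ∀ (v : V) (i : Fin (N.deg v)),
    (A.send (A.stateAfter N t v) i).length ≤ b

end DistAlgorithm

end

/-! ### Iterated logarithms and the length of colors -/

noncomputable section

/-! The optimum is at most the total edge weight, so it suffices to cut a `1 - 1/k - ε` share of
that weight. Given a proper coloring, the color classes could choose parts greedily, one class after
another, each vertex losing at most a `1/k` share of the weight to earlier classes. With unbounded
degrees a bounded number of colors forces defects, so the coloring is only required to leave at each
vertex an `ε` share of its weighted degree on monochromatic edges; this costs just another `ε`
(`le_cutWeight_of_greedy`).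

Such a coloring comes from Linial-style recoloring, starting from the identifiers. A color of bit
length `L` is read as a polynomial of degree below `L` over a prime field with more than `L²`
elements; the new color is a point together with the value there (`exists_hash`). By averaging, each
vertex has a point causing new collisions on at most a `1/L` share of its weight
(`exists_isLightSeed`). As the point is part of the color, the choices of the neighbors do not
interfere (`sum_recolor_eq_le`). Lengths drop from `L` to `O(log L)`, so `2 log* n` rounds reach a
constant length `K` (`iterate_shrinkTo_le`), and the defects add up geometrically to at most `2/K ≤
ε` (`sum_cutValue_eq_le`). The greedy phase then takes `2 ^ K` rounds, independently of `k`. -/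

theorem exists_iterate_logb_le_one (m : ℕ) :
    ∀ x : ℝ, x ≤ m → ∃ i, (Real.logb 2)^[i] x ≤ 1 := by
  induction m with
  | zero => exact fun x hx => ⟨0, by simp at hx ⊢; linarith⟩
  | succ m ih =>
    intro x hx
    by_cases h : x ≤ 1
    · exact ⟨0, h⟩
    by_cases h2 : x ≤ 2
    · refine ⟨1, ?_⟩
      simp only [Function.iterate_one]
      rw [Real.logb_le_iff_le_rpow (by norm_num) (by linarith)]
      simpa using h2
    · push Not at h h2
      obtain ⟨i, hi⟩ := ih (Real.logb 2 x) (by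
        push_cast at hx
        -- The tangent of `log` at `2`; with `log 2 > 1/2` it gives `log₂ x ≤ x - 1` for `x ≥ 2`.
        have h3 : Real.log x ≤ Real.log 2 + (x / 2 - 1) := by
          have := Real.log_le_sub_one_of_pos (x := x / 2) (by linarith)
          rw [Real.log_div (by linarith) (by norm_num)] at this
          linarith
        have h4 : 0.6 < Real.log 2 := by linarith [Real.log_two_gt_d9]
        have : Real.logb 2 x ≤ x - 1 := by
          rw [Real.logb, div_le_iff₀ (by linarith)]
          nlinarith
        linarith)
      exact ⟨i + 1, by simpa using hi⟩

theorem iterate_logb_logStar_le_one (n : ℕ) : (Real.logb 2)^[logStar n] (n : ℝ) ≤ 1 :=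
  Nat.sInf_mem (s := {i : ℕ | (Real.logb 2)^[i] (n : ℝ) ≤ 1})
    (exists_iterate_logb_le_one n n le_rfl)

/-- The bit length of the colors after one recoloring step, if it was `L` before. -/
def shrink (L : ℕ) : ℕ := 4 * Nat.clog 2 L + 2

theorem shrink_le {L : ℕ} (hL : 1 ≤ L) : (shrink L : ℝ) ≤ 4 * Real.logb 2 L + 6 := by
  have h : (Nat.clog 2 L : ℝ) ≤ Real.logb 2 L + 1 := by
    have := Real.natCeil_logb_natCast 2 L
    rw [← this]
    exact (Nat.ceil_lt_add_one
      (Real.logb_nonneg (by norm_num) (by exact_mod_cast hL))).le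
  unfold shrink
  push_cast
  linarith

open Filter in
theorem eventually_log_le_mul {δ : ℝ} (hδ : 0 < δ) : ∀ᶠ x : ℝ in atTop, Real.log x ≤ δ * x := by
  filter_upwards [Real.isLittleO_log_id_atTop.bound hδ, eventually_ge_atTop 0] with x hx h0
  simpa [abs_of_nonneg h0] using (le_abs_self _).trans hx

open Filter in
theorem eventually_two_mul_shrink_le : ∀ᶠ L : ℕ in atTop, 2 * shrink L ≤ L := by
  have h2 : 0 < Real.log 2 := Real.log_pos (by norm_num)
  have h := tendsto_natCast_atTop_atTop.eventually
    (eventually_log_le_mul (δ := Real.log 2 / 16) (by positivity))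
  filter_upwards [h, eventually_ge_atTop 24] with L hL hL'
  have h3 := shrink_le (L := L) (by omega)
  have h4 : Real.logb 2 L ≤ L / 16 := by
    rw [Real.logb, div_le_iff₀ h2]; linarith
  have h5 : (24 : ℝ) ≤ L := by exact_mod_cast hL'
  have : (2 * shrink L : ℝ) ≤ L := by linarith
  exact_mod_cast this

-- One step has the factor `4` in front of the logarithm; the second step more than absorbs it,
-- along with the constant `A`.
open Filter in
theorem eventually_shrink_shrink_le {A : ℝ} (hA : 0 < A) :
    ∀ᶠ L : ℕ in atTop, (shrink (shrink L) : ℝ) ≤ Real.logb 2 (L / A) := by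
  have h2 : 0 < Real.log 2 := Real.log_pos (by norm_num)
  have ht : Tendsto (fun L : ℕ => 4 * Real.logb 2 L + 6) atTop atTop :=
    tendsto_atTop_add_const_right _ _ (Tendsto.const_mul_atTop (by norm_num)
      ((Real.tendsto_logb_atTop (by norm_num)).comp tendsto_natCast_atTop_atTop))
  -- With `y = 4 log₂ L + 6`, two steps give at most `4 (y / 32) + 6`, which is at most `(y - 6) / 4
  -- - log₂ A` exactly when `y ≥ 60 + 8 log₂ A`.
  filter_upwards [ht.eventually (eventually_log_le_mul (δ := Real.log 2 / 32) (by positivity)),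
    ht.eventually_ge_atTop (60 + 8 * Real.logb 2 A), eventually_ge_atTop 1] with L h1 h3 hL
  have h4 := shrink_le (L := shrink L) (by unfold shrink; omega)
  have h5 := shrink_le hL
  have h6 : Real.logb 2 (shrink L) ≤ Real.logb 2 (4 * Real.logb 2 L + 6) :=
    Real.logb_le_logb_of_le (by norm_num) (by unfold shrink; positivity) h5
  have h7 : Real.logb 2 (4 * Real.logb 2 L + 6) ≤ (4 * Real.logb 2 L + 6) / 32 := by
    rw [Real.logb, div_le_iff₀ h2]; linarith
  rw [Real.logb_div (by positivity) hA.ne']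
  linarith

/-- Shrinking stops at bit length `K`. -/
def shrinkTo (K L : ℕ) : ℕ := if L ≤ K then L else shrink L

/-- Each pair of steps pays for one application of `log₂`: until the length reaches `K`, it stays
below `A` times the iterated logarithm. -/
theorem iterate_shrinkTo_le {K A n L : ℕ} (hA : 1 ≤ A) (hAK : A ≤ K) (hL : L ≤ K ∨ L ≤ A * n)
    (hK : ∀ L : ℕ, K ≤ L → (shrink (shrink L) : ℝ) ≤ Real.logb 2 (L / (A : ℝ))) :
    (shrinkTo K)^[2 * logStar n] L ≤ K := by
  have key : ∀ i : ℕ, (shrinkTo K)^[2 * i] L ≤ K ∨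
      ((shrinkTo K)^[2 * i] L : ℝ) ≤ A * (Real.logb 2)^[i] (n : ℝ) := by
    intro i
    induction i with
    | zero => exact hL.imp id fun h => by simpa using (by exact_mod_cast h : (L : ℝ) ≤ A * n)
    | succ i ih =>
      rw [show 2 * (i + 1) = 2 * i + 1 + 1 by ring, Function.iterate_succ_apply',
        Function.iterate_succ_apply', Function.iterate_succ_apply' (f := Real.logb 2)]
      set M := (shrinkTo K)^[2 * i] L
      by_cases h1 : M ≤ K
      · left; simp [shrinkTo, h1]
      by_cases h2 : shrink M ≤ K
      · left; simp [shrinkTo, h1, h2]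
      right
      have h3 : (M : ℝ) ≤ A * (Real.logb 2)^[i] (n : ℝ) := ih.resolve_left h1
      simp only [shrinkTo, h1, h2, if_false]
      have hA0 : (1 : ℝ) ≤ A := by exact_mod_cast hA
      have h4 := hK M (by omega)
      have h5 : Real.logb 2 (M / (A : ℝ)) ≤ Real.logb 2 ((Real.logb 2)^[i] (n : ℝ)) := by
        apply Real.logb_le_logb_of_le (by norm_num)
        · have : 0 < M := by omega
          positivity
        · rw [div_le_iff₀ (by linarith)]; linarith
      have h6 : (0 : ℝ) ≤ shrink (shrink M) := by positivity
      nlinarith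
  rcases key (logStar n) with h | h
  · exact h
  · have h1 := iterate_logb_logStar_le_one n
    have : ((shrinkTo K)^[2 * logStar n] L : ℝ) ≤ K := by
      have : (A : ℝ) ≤ K := by exact_mod_cast hAK
      have hA0 : (1 : ℝ) ≤ A := by exact_mod_cast hA
      nlinarith
    exact_mod_cast this

theorem shrinkTo_le {K L : ℕ} (hK : ∀ L : ℕ, K ≤ L → 2 * shrink L ≤ L) : shrinkTo K L ≤ L := by
  unfold shrinkTo
  split_ifs with h
  · exact le_rfl
  · have := hK L (by omega); omega

theorem iterate_shrinkTo_le_self {K : ℕ} (hK : ∀ L : ℕ, K ≤ L → 2 * shrink L ≤ L) (t L : ℕ) :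
    (shrinkTo K)^[t] L ≤ L := by
  induction t with
  | zero => exact le_rfl
  | succ t ih => rw [Function.iterate_succ_apply']; exact (shrinkTo_le hK).trans ih

/-! ### Hashing by polynomials; local choices by averaging -/

/-- A family of `q` maps to colors of bit length `shrink L`, with disjoint ranges, such that any two
colors of bit length `L` collide under a fraction of at most `1 / L` of the maps. -/
theorem exists_hash (L : ℕ) : ∃ (q : ℕ) (g : ℕ → ℕ → ℕ), 0 < q ∧
    (∀ a < q, ∀ x, g a x < 2 ^ shrink L) ∧
    (∀ a < q, ∀ b < q, ∀ x y, g a x = g b y → a = b) ∧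
    ∀ x < 2 ^ L, ∀ y < 2 ^ L, x ≠ y →
      ((Finset.range q).filter fun a => g a x = g a y).card * L ≤ q := by
  set j := 2 * Nat.clog 2 L with hj
  -- Bertrand's postulate: `q > L²` keeps collisions rare, while `q ≤ 2 ^ (j + 1)` keeps the colors,
  -- which are below `q²`, short.
  obtain ⟨q, hq, hjq, hqj⟩ := Nat.exists_prime_lt_and_le_two_mul (2 ^ j) (by positivity)
  have : Fact q.Prime := ⟨hq⟩
  have hLL : L * L ≤ 2 ^ j := by
    rw [hj, two_mul, pow_add]
    exact Nat.mul_le_mul (Nat.le_pow_clog (by norm_num) L) (Nat.le_pow_clog (by norm_num) L)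
  obtain ⟨φ⟩ : Nonempty (Fin (2 ^ L) ↪ (Fin L → ZMod q)) :=
    Function.Embedding.nonempty_of_card_le (by
      simpa using Nat.pow_le_pow_left hq.two_le L)
  let p : ℕ → Polynomial (ZMod q) := fun x =>
    ((Polynomial.degreeLTEquiv (ZMod q) L).symm (φ (Fin.ofNat (2 ^ L) x))).1
  have hpdeg : ∀ x, (p x).degree < L := fun x => Polynomial.mem_degreeLT.1 (Subtype.prop _)
  have hpinj : ∀ x < 2 ^ L, ∀ y < 2 ^ L, p x = p y → x = y := by
    intro x hx y hy h
    have := φ.injective ((Polynomial.degreeLTEquiv (ZMod q) L).symm.injective (Subtype.ext h))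
    simpa [Fin.ofNat, Fin.ext_iff, Nat.mod_eq_of_lt hx, Nat.mod_eq_of_lt hy] using this
  have hval : ∀ z : ZMod q, z.val < q := fun z => ZMod.val_lt z
  -- The pair of the point `a` and the value there, in base `q`; hence the ranges are disjoint.
  refine ⟨q, fun a x => a * q + ((p x).eval (a : ZMod q)).val, hq.pos, ?_, ?_, ?_⟩
  · intro a ha x
    have h1 := hval ((p x).eval (a : ZMod q))
    calc a * q + ((p x).eval (a : ZMod q)).val < a * q + q := by omega
      _ = (a + 1) * q := by ring
      _ ≤ (2 * 2 ^ j) * (2 * 2 ^ j) := Nat.mul_le_mul (by omega) hqj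
      _ = 2 ^ shrink L := by rw [show shrink L = j + j + 2 by unfold shrink; omega]; ring
  · intro a _ b _ x y h
    have h1 := congrArg (· / q) h
    simpa [Nat.mul_add_div hq.pos, mul_comm _ q, Nat.div_eq_of_lt (hval _)] using h1
  · intro x hx y hy hxy
    have hcard : ((Finset.range q).filter fun a : ℕ =>
        a * q + ((p x).eval (a : ZMod q)).val = a * q + ((p y).eval (a : ZMod q)).val).card
          < L := by
      by_contra! hc
      refine hxy (hpinj x hx y hy ?_)
      refine Polynomial.eq_of_degrees_lt_of_eval_index_eq (v := fun a : ℕ => (a : ZMod q)) _ ?_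
        ((hpdeg x).trans_le (by exact_mod_cast hc)) ((hpdeg y).trans_le (by exact_mod_cast hc)) ?_
      · intro a ha b hb hab
        simp only [Finset.coe_filter, Finset.mem_range, Set.mem_ofPred_eq] at ha hb
        have := (ZMod.natCast_eq_natCast_iff' a b q).1 hab
        rwa [Nat.mod_eq_of_lt ha.1, Nat.mod_eq_of_lt hb.1] at this
      · intro a ha
        have := (Finset.mem_filter.1 ha).2
        exact ZMod.val_injective q (by omega)
    exact (Nat.mul_le_mul_right L hcard.le).trans (hLL.trans hjq.le)

end
noncomputable section

/-- The number of maps in the hash family for colors of bit length `L`. -/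
def hashSize (L : ℕ) : ℕ := (exists_hash L).choose

/-- The hash family for colors of bit length `L`. -/
def hash (L : ℕ) : ℕ → ℕ → ℕ := (exists_hash L).choose_spec.choose

theorem hashSize_pos (L : ℕ) : 0 < hashSize L := (exists_hash L).choose_spec.choose_spec.1

theorem hash_lt {L a : ℕ} (ha : a < hashSize L) (x : ℕ) : hash L a x < 2 ^ shrink L :=
  (exists_hash L).choose_spec.choose_spec.2.1 a ha x

theorem hash_seed_eq {L a b x y : ℕ} (ha : a < hashSize L) (hb : b < hashSize L)
    (h : hash L a x = hash L b y) : a = b :=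
  (exists_hash L).choose_spec.choose_spec.2.2.1 a ha b hb x y h

theorem card_hash_eq_le {L x y : ℕ} (hx : x < 2 ^ L) (hy : y < 2 ^ L) (hxy : x ≠ y) :
    ((Finset.range (hashSize L)).filter fun a => hash L a x = hash L a y).card * L ≤ hashSize L :=
  (exists_hash L).choose_spec.choose_spec.2.2.2 x hx y hy hxy

/-- A seed `a` is light if the new collisions that it causes have a small total weight. -/
def IsLightSeed (L : ℕ) {d : ℕ} (w : Fin d → ℝ) (x : ℕ) (y : Fin d → ℕ) (a : ℕ) : Prop :=
  a < hashSize L ∧ L * ∑ i with y i ≠ x ∧ hash L a x = hash L a (y i), w i ≤ ∑ i, w i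

/-- Averaged over all seeds, each neighbor of a different color collides with frequency at most `1 /
L`, so some seed is no worse than average. -/
theorem exists_isLightSeed {L d : ℕ} {w : Fin d → ℝ} (hw : ∀ i, 0 ≤ w i) {x : ℕ} {y : Fin d → ℕ}
    (hx : x < 2 ^ L) (hy : ∀ i, y i < 2 ^ L) : ∃ a, IsLightSeed L w x y a := by
  obtain ⟨a, ha, h⟩ := Finset.exists_le_of_sum_le
    (s := Finset.range (hashSize L))
    (f := fun a => L * ∑ i with y i ≠ x ∧ hash L a x = hash L a (y i), w i)
    (g := fun _ => ∑ i, w i) (by simpa using (hashSize_pos L).ne') (by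
      simp only [Finset.sum_filter, ← Finset.mul_sum]
      rw [Finset.sum_comm, Finset.mul_sum, Finset.sum_const, Finset.card_range, nsmul_eq_mul,
        Finset.mul_sum]
      refine Finset.sum_le_sum fun i _ => ?_
      by_cases hxy : y i = x
      · simpa [hxy] using mul_nonneg (Nat.cast_nonneg _) (hw i)
      · have h1 := card_hash_eq_le hx (hy i) (Ne.symm hxy)
        have h2 : (((Finset.range (hashSize L)).filter fun a =>
            hash L a x = hash L a (y i)).card * L : ℝ) ≤ hashSize L := by exact_mod_cast h1
        simp only [ne_eq, hxy, not_false_eq_true, true_and]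
        rw [← Finset.sum_filter, Finset.sum_const, nsmul_eq_mul]
        nlinarith [hw i])
  exact ⟨a, Finset.mem_range.1 ha, h⟩

/-- The new color of a vertex of color `x`, of bit length `L`, whose neighbors have the
colors `y`. -/
def recolor (L : ℕ) {d : ℕ} (w : Fin d → ℝ) (x : ℕ) (y : Fin d → ℕ) : ℕ :=
  hash L (Classical.epsilon (IsLightSeed L w x y)) x

/-- A part is light if it has at most an average share of the weight of the edges to the neighbors
of color below `x`. -/
def IsLightPart {k d : ℕ} (w : Fin d → ℝ) (x : ℕ) (y : Fin d → ℕ × Fin k) (a : Fin k) : Prop :=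
  k * ∑ i with (y i).1 < x ∧ (y i).2 = a, w i ≤ ∑ i with (y i).1 < x, w i

theorem exists_isLightPart {k d : ℕ} [NeZero k] (w : Fin d → ℝ) (x : ℕ) (y : Fin d → ℕ × Fin k) :
    ∃ a, IsLightPart w x y a := by
  obtain ⟨a, -, h⟩ := Finset.exists_le_of_sum_le (s := (Finset.univ : Finset (Fin k)))
    (f := fun a => k * ∑ i with (y i).1 < x ∧ (y i).2 = a, w i)
    (g := fun _ => ∑ i with (y i).1 < x, w i) Finset.univ_nonempty (by
      rw [← Finset.mul_sum, Finset.sum_const, Finset.card_univ, Fintype.card_fin, nsmul_eq_mul]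
      refine le_of_eq (congrArg _ ?_)
      simp only [← Finset.filter_filter]
      exact Finset.sum_fiberwise _ (fun i => (y i).2) w)
  exact ⟨a, h⟩

/-! ### Broadcast algorithms and the cut algorithm -/

/-- The state of a vertex in an algorithm that broadcasts a value in every round. -/
structure BroadcastState (S : Type) (d : ℕ) where
  size : ℕ
  time : ℕ
  weights : Fin d → ℝ
  value : S

/-- The algorithm in which every vertex holds a value, sends it, encoded by `enc`, to all of its
neighbors in every round, and updates it by `step`. -/
def broadcastAlgorithm {S Out : Type} [Nonempty S] (enc : S → List Bool) (init : ℕ → S)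
    (step : ℕ → ℕ → ∀ {d : ℕ}, (Fin d → ℝ) → S → (Fin d → S) → S) (rounds : ℕ → ℕ)
    (out : S → Out) : DistAlgorithm Out where
  State := BroadcastState S
  init n ident w := ⟨n, 0, w, init ident⟩
  send s _ := enc s.value
  receive s m := ⟨s.size, s.time + 1, s.weights,
    step s.size s.time s.weights s.value fun i => Function.invFun enc (m i)⟩
  rounds := rounds
  output s := out s.value

/-- The weights of the edges at `v`, by port number. -/
abbrev Network.portWeight {V : Type} (N : Network V) (v : V) (i : Fin (N.deg v)) : ℝ :=
  N.weight s(v, (N.port v i : V))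

/-- The values of the vertices after `t` rounds of a broadcast algorithm. -/
def broadcastValue {S V : Type} [Fintype V] (init : ℕ → S)
    (step : ℕ → ℕ → ∀ {d : ℕ}, (Fin d → ℝ) → S → (Fin d → S) → S) (N : Network V) : ℕ → V → S
  | 0, v => init (N.ident v)
  | t + 1, v => step (Fintype.card V) t (N.portWeight v) (broadcastValue init step N t v)
      fun i => broadcastValue init step N t (N.port v i)

/-- Since `enc` is injective, `Function.invFun enc` decodes every message sent, so executions can be
studied through the values alone. -/
theorem stateAfter_broadcastAlgorithm {S Out V : Type} [Nonempty S] [Fintype V]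
    {enc : S → List Bool} (henc : Function.Injective enc) (init : ℕ → S)
    (step : ℕ → ℕ → ∀ {d : ℕ}, (Fin d → ℝ) → S → (Fin d → S) → S) (rounds : ℕ → ℕ)
    (out : S → Out) (N : Network V) (t : ℕ) (v : V) :
    (broadcastAlgorithm enc init step rounds out).stateAfter N t v =
      (⟨Fintype.card V, t, N.portWeight v, broadcastValue init step N t v⟩ :
        BroadcastState S (N.deg v)) := by
  induction t generalizing v with
  | zero => rfl
  | succ t ih =>
    simp only [DistAlgorithm.stateAfter, ih]
    simp only [broadcastAlgorithm, broadcastValue, Function.leftInverse_invFun henc _]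

/-- The binary encoding of a color and a part. -/
def encodeColorPart {k : ℕ} (s : ℕ × Fin k) : List Bool := Nat.bits (s.1 * k + s.2)

theorem Nat.bits_injective : Function.Injective Nat.bits := fun m n h =>
  Nat.eq_of_testBit_eq fun i => by rw [Nat.testBit_eq_inth, Nat.testBit_eq_inth, h]

theorem encodeColorPart_injective {k : ℕ} : Function.Injective (encodeColorPart (k := k)) := by
  rintro ⟨x, a⟩ ⟨y, b⟩ h
  have h := Nat.bits_injective h
  have hk : 0 < k := a.pos
  have h1 := congrArg (· / k) h
  have h2 := congrArg (· % k) h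
  simp only [Nat.mul_comm _ k, Nat.mul_add_div hk, Nat.div_eq_of_lt a.2, Nat.div_eq_of_lt b.2,
    Nat.mul_add_mod, Nat.mod_eq_of_lt a.2, Nat.mod_eq_of_lt b.2, add_zero] at h1 h2
  exact Prod.ext h1 (Fin.ext h2)

theorem length_encodeColorPart_le {k L : ℕ} {s : ℕ × Fin k} (h : s.1 < 2 ^ L) :
    (encodeColorPart s).length ≤ L + k := by
  rw [encodeColorPart, Nat.size_eq_bits_len, Nat.size_le, pow_add]
  calc s.1 * k + s.2 < s.1 * k + k := by omega
    _ = (s.1 + 1) * k := by ring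
    _ ≤ 2 ^ L * 2 ^ k := Nat.mul_le_mul h Nat.lt_two_pow_self.le

/-- The bit length of the colors after `t` recoloring rounds. -/
def colorLength (K c n t : ℕ) : ℕ := (shrinkTo K)^[t] (c * (Nat.log 2 n + 1))

/-- One round of the cut algorithm. In the first `2 log* n` rounds the vertices reduce the number of
colors; then the color classes choose their parts greedily, one color class per round. -/
def cutStep (K c k n t : ℕ) {d : ℕ} (w : Fin d → ℝ) (s : ℕ × Fin k) (y : Fin d → ℕ × Fin k) :
    ℕ × Fin k :=
  if t < 2 * logStar n then
    (if colorLength K c n t ≤ K then s.1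
      else recolor (colorLength K c n t) w s.1 fun i => (y i).1, s.2)
  else if s.1 = t - 2 * logStar n then
    haveI : Nonempty (Fin k) := ⟨s.2⟩
    (s.1, Classical.epsilon (IsLightPart w s.1 y))
  else s

/-- The cut algorithm: recoloring until the colors have bit length at most `K`, and a greedy choice
of parts. -/
def cutAlgorithm (K c k : ℕ) [NeZero k] : DistAlgorithm (Fin k) :=
  broadcastAlgorithm encodeColorPart (fun x => (x, (0 : Fin k))) (fun n t => cutStep K c k n t)
    (fun n => 2 * logStar n + 2 ^ K) Prod.snd

end
-- Weighted degrees and the greedy cut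
noncomputable section

open Classical in
theorem two_mul_sum_edgeFinset {V : Type} [Fintype V] (G : SimpleGraph V) (φ : Sym2 V → ℝ) :
    2 * ∑ e ∈ G.edgeFinset, φ e = ∑ v, ∑ u, if G.Adj v u then φ s(v, u) else 0 := by
  have h1 : ∑ d : G.Dart, φ d.edge = 2 * ∑ e ∈ G.edgeFinset, φ e := by
    rw [← Finset.sum_fiberwise_of_maps_to (s := Finset.univ) (t := G.edgeFinset)
      (g := fun d : G.Dart => d.edge) (fun d _ => G.mem_edgeFinset.2 d.edge_mem), Finset.mul_sum]
    refine Finset.sum_congr rfl fun e he => ?_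
    rw [Finset.sum_congr rfl (g := fun _ => φ e) fun d hd => by rw [(Finset.mem_filter.1 hd).2],
      Finset.sum_const, G.dart_edge_fiber_card e (G.mem_edgeFinset.1 he), nsmul_eq_mul]
    norm_num
  rw [← h1, ← Fintype.sum_prod_type' (f := fun v u => if G.Adj v u then φ s(v, u) else 0),
    ← Finset.sum_filter]
  refine Finset.sum_bij' (fun d _ => (d.fst, d.snd))
    (fun p hp => ⟨p, (Finset.mem_filter.1 hp).2⟩) ?_ ?_ ?_ ?_ ?_ <;> simp
  intro d; rfl

namespace Network

variable {V : Type} (N : Network V)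

open Classical in
/-- The weight of the edge between `v` and `u`, which is `0` if there is none. -/
def pairWeight (v u : V) : ℝ := if N.graph.Adj v u then N.weight s(v, u) else 0

theorem pairWeight_comm (v u : V) : N.pairWeight v u = N.pairWeight u v := by
  unfold pairWeight
  classical exact if_congr (N.graph.adj_comm v u) (by rw [Sym2.eq_swap]) rfl

theorem pairWeight_self (v : V) : N.pairWeight v v = 0 := by simp [pairWeight]

theorem pairWeight_nonneg (v u : V) : 0 ≤ N.pairWeight v u := by
  unfold pairWeight
  split_ifs with h
  · exact (N.weight_pos _ h).le
  · exact le_rfl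

theorem portWeight_nonneg (v : V) (i : Fin (N.deg v)) : 0 ≤ N.portWeight v i :=
  (N.weight_pos _ (N.port v i).2).le

variable [Fintype V]

theorem sum_portWeight (v : V) (P : V → Prop) [DecidablePred P] :
    ∑ i with P (N.port v i), N.portWeight v i = ∑ u with P u, N.pairWeight v u := by
  classical
  simp only [Finset.sum_filter, portWeight]
  rw [(N.port v).sum_comp (fun u => if P u then N.weight s(v, (u : V)) else 0)]
  rw [← Finset.sum_subtype (Finset.univ.filter fun u => N.graph.Adj v u) (by simp)
    fun u => if P u then N.weight s(v, u) else 0, Finset.sum_filter]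
  refine Finset.sum_congr rfl fun u _ => ?_
  by_cases h : N.graph.Adj v u <;> simp [pairWeight, h]

/-- The total weight of the edges at `v`. -/
def weightedDegree (v : V) : ℝ := ∑ u, N.pairWeight v u

theorem weightedDegree_nonneg (v : V) : 0 ≤ N.weightedDegree v :=
  Finset.sum_nonneg fun _ _ => N.pairWeight_nonneg _ _

theorem sum_portWeight_univ (v : V) : ∑ i, N.portWeight v i = N.weightedDegree v := by
  simpa only [Finset.sum_filter, if_true, weightedDegree] using N.sum_portWeight v fun _ => True

theorem two_mul_cutWeight {k : ℕ} (X : V → Fin k) :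
    2 * cutWeight N.graph N.weight X + ∑ v, ∑ u with X u = X v, N.pairWeight v u =
      ∑ v, N.weightedDegree v := by
  classical
  unfold cutWeight
  rw [Finset.sum_filter, two_mul_sum_edgeFinset, ← Finset.sum_add_distrib]
  refine Finset.sum_congr rfl fun v _ => ?_
  rw [Finset.sum_filter, ← Finset.sum_add_distrib]
  refine Finset.sum_congr rfl fun u _ => ?_
  by_cases h : N.graph.Adj v u <;> by_cases h' : X v = X u <;>
    simp [pairWeight, h, h', eq_comm]

theorem two_mul_cutWeight_le {k : ℕ} (X : V → Fin k) :
    2 * cutWeight N.graph N.weight X ≤ ∑ v, N.weightedDegree v := by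
  rw [← N.two_mul_cutWeight X]
  exact le_add_of_nonneg_right
    (Finset.sum_nonneg fun v _ => Finset.sum_nonneg fun u _ => N.pairWeight_nonneg v u)

theorem cutWeight_nonneg {k : ℕ} (X : V → Fin k) : 0 ≤ cutWeight N.graph N.weight X :=
  Finset.sum_nonneg fun e he => (N.weight_pos e (by
    classical
    simpa using (Finset.mem_filter.1 he).1)).le

theorem two_mul_maxKCut_le (k : ℕ) [NeZero k] :
    2 * maxKCut N.graph N.weight k ≤ ∑ v, N.weightedDegree v := by
  have : maxKCut N.graph N.weight k ≤ (∑ v, N.weightedDegree v) / 2 :=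
    ciSup_le fun X => by linarith [N.two_mul_cutWeight_le X]
  linarith

theorem maxKCut_nonneg (k : ℕ) : 0 ≤ maxKCut N.graph N.weight k :=
  Real.iSup_nonneg fun X => N.cutWeight_nonneg X

/-- A coloring with weighted defect `δ`, whose color classes choose their parts greedily one after
the other, yields a large cut. -/
theorem le_cutWeight_of_greedy {k : ℕ} (hk : 0 < k) {δ : ℝ} (C : V → ℕ) (X : V → Fin k)
    (hC : ∀ v, ∑ u with C u = C v, N.pairWeight v u ≤ δ * N.weightedDegree v)
    (hX : ∀ v, k * ∑ u with C u < C v ∧ X u = X v, N.pairWeight v u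
      ≤ ∑ u with C u < C v, N.pairWeight v u) :
    (1 - 1 / (k : ℝ) - δ) * ∑ v, N.weightedDegree v ≤ 2 * cutWeight N.graph N.weight X := by
  have hk' : (0 : ℝ) < k := by exact_mod_cast hk
  have hswap : ∀ (R : V → V → Prop) [DecidableRel R], (∀ u v, R u v ↔ R v u) →
      ∑ v, ∑ u with C v < C u ∧ R u v, N.pairWeight v u =
      ∑ v, ∑ u with C u < C v ∧ R u v, N.pairWeight v u := by
    intro R _ hR
    simp only [Finset.sum_filter]
    rw [Finset.sum_comm]
    refine Finset.sum_congr rfl fun v _ => Finset.sum_congr rfl fun u _ => ?_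
    exact if_congr (and_congr_right fun _ => hR v u) (N.pairWeight_comm u v) rfl
  have hsplit : ∀ (R : V → V → Prop) [DecidableRel R], (∀ u v, R u v ↔ R v u) →
      ∑ v, ∑ u with R u v, N.pairWeight v u =
      ∑ v, ∑ u with C u = C v ∧ R u v, N.pairWeight v u +
      2 * ∑ v, ∑ u with C u < C v ∧ R u v, N.pairWeight v u := by
    intro R _ hR
    rw [two_mul]
    nth_rewrite 1 [← hswap R hR]
    simp only [← Finset.sum_add_distrib, Finset.sum_filter]
    refine Finset.sum_congr rfl fun v _ => Finset.sum_congr rfl fun u _ => ?_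
    by_cases hR : R u v
    · rcases lt_trichotomy (C u) (C v) with h | h | h
      · simp [h, hR, h.ne, h.not_gt]
      · simp [h, hR]
      · simp [h, hR, h.ne', h.not_gt]
    · simp [hR]
  have h1 := hsplit (fun u v => X u = X v) fun u v => eq_comm
  have h2 := hsplit (fun _ _ => True) fun _ _ => Iff.rfl
  simp only [and_true, Finset.filter_true] at h2
  have h3 : ∑ v, ∑ u with C u = C v ∧ X u = X v, N.pairWeight v u ≤
      δ * ∑ v, N.weightedDegree v := by
    rw [Finset.mul_sum]
    refine Finset.sum_le_sum fun v _ => le_trans ?_ (hC v)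
    exact Finset.sum_le_sum_of_subset_of_nonneg
      (Finset.monotone_filter_right _ fun u _ h => h.1) fun u _ _ => N.pairWeight_nonneg v u
  have h4 : k * ∑ v, ∑ u with C u < C v ∧ X u = X v, N.pairWeight v u ≤
      ∑ v, ∑ u with C u < C v, N.pairWeight v u := by
    rw [Finset.mul_sum]
    exact Finset.sum_le_sum fun v _ => hX v
  have h5 : 0 ≤ ∑ v, ∑ u with C u = C v, N.pairWeight v u :=
    Finset.sum_nonneg fun v _ => Finset.sum_nonneg fun u _ => N.pairWeight_nonneg v u
  have h6 := N.two_mul_cutWeight X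
  rw [h1] at h6
  change ∑ v, N.weightedDegree v = _ at h2
  set W := ∑ v, N.weightedDegree v
  -- Ordered pairs with distinct colors have total weight at most `W`, half of it going to lower
  -- colors; the greedy choice leaves a `1/k` share uncut.
  have h7 : 2 * ∑ v, ∑ u with C u < C v ∧ X u = X v, N.pairWeight v u ≤ 1 / (k : ℝ) * W := by
    rw [div_mul_eq_mul_div, le_div_iff₀ hk']
    linarith
  linarith [sub_mul (1 - 1 / (k : ℝ)) δ W, sub_mul 1 (1 / (k : ℝ)) W]

end Network

theorem epsilon_isLightSeed {V : Type} {N : Network V} {L : ℕ} {v : V} {f : V → ℕ} (hf : ∀ u, f u < 2 ^ L) :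
    IsLightSeed L (N.portWeight v) (f v) (fun i => f (N.port v i))
      (Classical.epsilon (IsLightSeed L (N.portWeight v) (f v) fun i => f (N.port v i))) :=
  Classical.epsilon_spec (exists_isLightSeed (N.portWeight_nonneg v) (hf v) fun _ => hf _)

theorem recolor_lt {V : Type} {N : Network V} {L : ℕ} {v : V} {f : V → ℕ} (hf : ∀ u, f u < 2 ^ L) :
    recolor L (N.portWeight v) (f v) (fun i => f (N.port v i)) < 2 ^ shrink L :=
  hash_lt (epsilon_isLightSeed hf).1 _

/-! ### Correctness of the cut algorithm -/

section Correctness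

variable {V : Type} [Fintype V] (N : Network V) (K c k : ℕ) [NeZero k]

/-- The color and the part of each vertex after `t` rounds of the cut algorithm. -/
abbrev cutValue (t : ℕ) (v : V) : ℕ × Fin k :=
  broadcastValue (fun x => (x, (0 : Fin k))) (fun n t => cutStep K c k n t) N t v

variable {K c} {N}

theorem cutValue_fst_succ {t : ℕ} (ht : t < 2 * logStar (Fintype.card V)) (v : V) :
    (cutValue N K c k (t + 1) v).1 =
      if colorLength K c (Fintype.card V) t ≤ K then (cutValue N K c k t v).1
      else recolor (colorLength K c (Fintype.card V) t) (N.portWeight v) (cutValue N K c k t v).1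
        fun i => (cutValue N K c k t (N.port v i)).1 := by
  simp only [cutValue, broadcastValue, cutStep, if_pos ht]

theorem cutValue_fst_add (i : ℕ) (v : V) :
    (cutValue N K c k (2 * logStar (Fintype.card V) + i) v).1 =
      (cutValue N K c k (2 * logStar (Fintype.card V)) v).1 := by
  induction i with
  | zero => rfl
  | succ i ih =>
    rw [← ih, ← add_assoc]
    simp only [cutValue, broadcastValue, cutStep]
    rw [if_neg (by omega)]
    split_ifs <;> rfl

theorem colorLength_succ (n t : ℕ) :
    colorLength K c n (t + 1) = shrinkTo K (colorLength K c n t) :=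
  Function.iterate_succ_apply' _ _ _

/-- Equal new colors force equal seeds, so every new collision at `v` is already one under the seed
that `v` chose itself, whatever its neighbors did. -/
theorem sum_recolor_eq_le {L : ℕ} (hL : 0 < L) (v : V) {f g : V → ℕ} (hf : ∀ u, f u < 2 ^ L)
    (hg : ∀ u, g u = recolor L (N.portWeight u) (f u) fun i => f (N.port u i)) :
    ∑ u with g u = g v, N.pairWeight v u ≤
      ∑ u with f u = f v, N.pairWeight v u + 1 / L * N.weightedDegree v := by
  classical
  set s := fun u => Classical.epsilon
    (IsLightSeed L (N.portWeight u) (f u) fun i => f (N.port u i)) with hs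
  have hspec : ∀ u, IsLightSeed L (N.portWeight u) (f u) (fun i => f (N.port u i)) (s u) :=
    fun u => epsilon_isLightSeed hf
  have hg' : ∀ u, g u = hash L (s u) (f u) := hg
  have h1 := (hspec v).2
  rw [N.sum_portWeight v (fun u => f u ≠ f v ∧ hash L (s v) (f v) = hash L (s v) (f u)),
    N.sum_portWeight_univ] at h1
  have h2 : ∑ u with f u ≠ f v ∧ hash L (s v) (f v) = hash L (s v) (f u), N.pairWeight v u ≤
      1 / L * N.weightedDegree v := by
    rw [one_div_mul_eq_div, le_div_iff₀ (by exact_mod_cast hL)]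
    linarith
  refine le_trans ?_ (add_le_add_right h2 _)
  simp only [Finset.sum_filter, ← Finset.sum_add_distrib]
  refine Finset.sum_le_sum fun u _ => ?_
  have h0 := N.pairWeight_nonneg v u
  by_cases h : g u = g v
  · by_cases h' : f u = f v
    · simp [h, h']
    · have h3 : hash L (s u) (f u) = hash L (s v) (f v) := by rw [← hg', ← hg', h]
      have h4 := hash_seed_eq (hspec u).1 (hspec v).1 h3
      rw [h4] at h3
      simp [h, h', h3]
  · rw [if_neg h]
    positivity

theorem cutValue_fst_lt (hid : ∀ v, N.ident v < Fintype.card V ^ c) {t : ℕ}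
    (ht : t ≤ 2 * logStar (Fintype.card V)) (v : V) :
    (cutValue N K c k t v).1 < 2 ^ colorLength K c (Fintype.card V) t := by
  induction t generalizing v with
  | zero =>
    refine (hid v).trans_le ?_
    rw [colorLength, Function.iterate_zero_apply, mul_comm, pow_mul]
    exact Nat.pow_le_pow_left (Nat.lt_pow_succ_log_self (by norm_num) _).le c
  | succ t ih =>
    rw [cutValue_fst_succ k (by omega), colorLength_succ, shrinkTo]
    have ih' := fun u => ih (by omega) u
    split_ifs with h
    · exact ih' v
    · exact recolor_lt (f := fun u => (cutValue N K c k t u).1) ih'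

/-- The defect is `0` for distinct identifiers. If it is at most `1/L`, a recoloring raises it to at
most `2/L`, which is below `2/K` since `L > K`, and below one over the new length since lengths at
least halve. This restores the invariant without summing a series. -/
theorem sum_cutValue_eq_le (hid : ∀ v, N.ident v < Fintype.card V ^ c) (hK0 : 0 < K)
    (hK : ∀ L : ℕ, K ≤ L → 2 * shrink L ≤ L) {t : ℕ} (ht : t ≤ 2 * logStar (Fintype.card V)) :
    ∃ δ : ℝ, δ ≤ 2 / K ∧
      (K < colorLength K c (Fintype.card V) t → δ ≤ 1 / colorLength K c (Fintype.card V) t) ∧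
      ∀ v, ∑ u with (cutValue N K c k t u).1 = (cutValue N K c k t v).1, N.pairWeight v u ≤
        δ * N.weightedDegree v := by
  classical
  induction t with
  | zero =>
    refine ⟨0, by positivity, fun _ => by positivity, fun v => ?_⟩
    rw [zero_mul]
    refine Finset.sum_nonpos fun u hu => ?_
    rw [N.ident_injective (Finset.mem_filter.1 hu).2, N.pairWeight_self]
  | succ t ih =>
    obtain ⟨δ, h1, h2, h3⟩ := ih (by omega)
    have hsucc := cutValue_fst_succ (N := N) (K := K) (c := c) k
      (show t < 2 * logStar (Fintype.card V) by omega)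
    simp only [hsucc, colorLength_succ, shrinkTo]
    set L := colorLength K c (Fintype.card V) t with hL
    by_cases h : L ≤ K
    · simp only [h, if_true]
      exact ⟨δ, h1, h2, h3⟩
    · simp only [h, if_false]
      push Not at h
      have hK0' : (0 : ℝ) < K := by exact_mod_cast hK0
      have hKL : (K : ℝ) < L := by exact_mod_cast h
      have hL0 : (0 : ℝ) < L := hK0'.trans hKL
      have h4 := h2 h
      have h5 : δ + 1 / L ≤ 2 / L := by linarith [show (2 : ℝ) / L = 1 / L + 1 / L by ring]
      refine ⟨δ + 1 / L, h5.trans (by gcongr), fun h6 => h5.trans ?_, fun v => ?_⟩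
      · have h7 : (2 * shrink L : ℝ) ≤ L := by exact_mod_cast hK L h.le
        have h8 : (0 : ℝ) < shrink L := by exact_mod_cast hK0.trans h6
        rw [div_le_div_iff₀ hL0 h8]
        linarith
      · rw [add_mul]
        exact (sum_recolor_eq_le (f := fun u => (cutValue N K c k t u).1) (hK0.trans h) v
          (cutValue_fst_lt k hid (by omega)) fun u => rfl).trans (add_le_add_left (h3 v) _)

theorem cutValue_snd_succ_of_ne {i : ℕ} {v : V}
    (h : (cutValue N K c k (2 * logStar (Fintype.card V)) v).1 ≠ i) :
    (cutValue N K c k (2 * logStar (Fintype.card V) + i + 1) v).2 =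
      (cutValue N K c k (2 * logStar (Fintype.card V) + i) v).2 := by
  have h1 := cutValue_fst_add (N := N) (K := K) (c := c) k i v
  rw [← h1] at h
  simp only [cutValue] at h
  simp only [cutValue, broadcastValue, cutStep]
  rw [if_neg (by omega), if_neg (by rwa [Nat.add_sub_cancel_left])]

/-- A vertex changes its part only in the round of its color. Hence later classes see its final part
when they choose. -/
theorem cutValue_snd_of_lt {i j : ℕ} {v : V} (hij : i ≤ j)
    (h : (cutValue N K c k (2 * logStar (Fintype.card V)) v).1 < i) :
    (cutValue N K c k (2 * logStar (Fintype.card V) + j) v).2 =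
      (cutValue N K c k (2 * logStar (Fintype.card V) + i) v).2 := by
  induction j, hij using Nat.le_induction with
  | base => rfl
  | succ j hij ih => rw [← ih, ← add_assoc]; exact cutValue_snd_succ_of_ne k (by omega)

theorem isLightPart_cutValue {i : ℕ} {v : V}
    (h : (cutValue N K c k (2 * logStar (Fintype.card V)) v).1 = i) :
    IsLightPart (N.portWeight v) i
      (fun j => cutValue N K c k (2 * logStar (Fintype.card V) + i) (N.port v j))
      (cutValue N K c k (2 * logStar (Fintype.card V) + i + 1) v).2 := by
  have h1 := cutValue_fst_add (N := N) (K := K) (c := c) k i v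
  rw [h] at h1
  have h2 : (cutValue N K c k (2 * logStar (Fintype.card V) + i + 1) v).2 =
      Classical.epsilon (IsLightPart (N.portWeight v) i
        fun j => cutValue N K c k (2 * logStar (Fintype.card V) + i) (N.port v j)) := by
    simp only [cutValue] at h1
    simp only [cutValue, broadcastValue, cutStep]
    rw [if_neg (by omega), if_pos (by rw [h1]; omega), h1]
  rw [h2]
  exact Classical.epsilon_spec (exists_isLightPart _ _ _)

theorem cutAlgorithm_result (v : V) :
    (cutAlgorithm K c k).result N v =
      (cutValue N K c k (2 * logStar (Fintype.card V) + 2 ^ K) v).2 := by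
  unfold DistAlgorithm.result cutAlgorithm
  rw [stateAfter_broadcastAlgorithm encodeColorPart_injective]
  rfl

theorem le_cutWeight_cutAlgorithm (hid : ∀ v, N.ident v < Fintype.card V ^ c) (hK0 : 0 < K)
    (hK : ∀ L : ℕ, K ≤ L → 2 * shrink L ≤ L)
    (hlen : colorLength K c (Fintype.card V) (2 * logStar (Fintype.card V)) ≤ K) :
    (1 - 1 / (k : ℝ) - 2 / K) * ∑ v, N.weightedDegree v ≤
      2 * cutWeight N.graph N.weight ((cutAlgorithm K c k).result N) := by
  set T := 2 * logStar (Fintype.card V) with hT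
  have hC : ∀ v, (cutValue N K c k T v).1 < 2 ^ K := fun v =>
    (cutValue_fst_lt k hid le_rfl v).trans_le (Nat.pow_le_pow_right (by norm_num) hlen)
  refine N.le_cutWeight_of_greedy (NeZero.pos k) (fun v => (cutValue N K c k T v).1) _
    (fun v => ?_) fun v => ?_
  · obtain ⟨δ, h1, -, h3⟩ := sum_cutValue_eq_le k hid hK0 hK le_rfl
    exact (h3 v).trans (mul_le_mul_of_nonneg_right h1 (N.weightedDegree_nonneg v))
  · have h1 := isLightPart_cutValue (N := N) (K := K) (c := c) k (v := v) rfl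
    simp only [IsLightPart, cutValue_fst_add] at h1
    rw [N.sum_portWeight v (fun u => (cutValue N K c k T u).1 < (cutValue N K c k T v).1),
      N.sum_portWeight v (fun u => (cutValue N K c k T u).1 < (cutValue N K c k T v).1 ∧
        (cutValue N K c k (T + (cutValue N K c k T v).1) u).2 =
        (cutValue N K c k (T + (cutValue N K c k T v).1 + 1) v).2)] at h1
    -- The light-part inequality speaks of the parts at the time of the choice; for lower colors and
    -- for `v` itself these are already the final ones.
    convert h1 using 3
    refine Finset.filter_congr fun u _ => and_congr_right fun hu => ?_
    rw [cutAlgorithm_result, cutAlgorithm_result, cutValue_snd_of_lt k (hC v).le hu,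
      cutValue_snd_of_lt k (hC v) (Nat.lt_succ_self _), add_assoc]

theorem messagesBoundedBy_cutAlgorithm (hid : ∀ v, N.ident v < Fintype.card V ^ c)
    (hK : ∀ L : ℕ, K ≤ L → 2 * shrink L ≤ L) :
    (cutAlgorithm K c k).MessagesBoundedBy N ((c + k) * (Nat.log 2 (Fintype.card V) + 1)) := by
  intro t _ v i
  unfold cutAlgorithm
  rw [stateAfter_broadcastAlgorithm encodeColorPart_injective]
  have h : (cutValue N K c k t v).1 < 2 ^ (c * (Nat.log 2 (Fintype.card V) + 1)) := by
    have hle : ∀ t, 2 ^ colorLength K c (Fintype.card V) t ≤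
        2 ^ (c * (Nat.log 2 (Fintype.card V) + 1)) := fun t =>
      Nat.pow_le_pow_right (by norm_num) (iterate_shrinkTo_le_self hK _ _)
    rcases le_total t (2 * logStar (Fintype.card V)) with ht | ht
    · exact (cutValue_fst_lt k hid ht v).trans_le (hle t)
    · obtain ⟨j, rfl⟩ := Nat.exists_eq_add_of_le ht
      rw [cutValue_fst_add]
      exact (cutValue_fst_lt k hid le_rfl v).trans_le (hle _)
  refine (length_encodeColorPart_le h).trans ?_
  rw [add_mul]
  exact Nat.add_le_add_left (Nat.le_mul_of_pos_right k (Nat.succ_pos _)) _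

end Correctness

/-! ### Choice of the constants and conclusion -/

open Filter in
theorem exists_final_colorLength (ε : ℝ) (hε : 0 < ε) (c : ℕ) : ∃ K : ℕ, 0 < K ∧ 2 / K ≤ ε ∧
    (∀ L : ℕ, K ≤ L → 2 * shrink L ≤ L) ∧
    ∀ n : ℕ, colorLength K c n (2 * logStar n) ≤ K := by
  obtain ⟨K, ⟨⟨h1, h2⟩, h3⟩, h4⟩ := (((eventually_forall_ge_atTop.2
    eventually_two_mul_shrink_le).and (eventually_forall_ge_atTop.2
      (eventually_shrink_shrink_le (A := (c + 1 : ℕ)) (by positivity)))).and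
    (eventually_ge_atTop (c + 1))).and
      (tendsto_natCast_atTop_atTop.eventually_ge_atTop (2 / ε)) |>.exists
  have hK : 0 < K := by omega
  refine ⟨K, hK, ?_, h1, fun n => iterate_shrinkTo_le (A := c + 1) (by omega) h3 ?_ h2⟩
  · rw [div_le_iff₀ (by exact_mod_cast hK)]
    rw [div_le_iff₀ hε] at h4
    linarith
  · rcases Nat.eq_zero_or_pos n with rfl | hn
    · left; simp; omega
    · right
      -- The initial length is at most `(c + 1) n`, which is why `A = c + 1`.
      exact Nat.mul_le_mul (Nat.le_succ c) (Nat.log_lt_self 2 hn.ne')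

end

theorem mainTheorem1 (ε : ℝ) (hε : 0 < ε) (c : ℕ) :
    ∃ C : ℕ, ∀ k : ℕ, 1 ≤ k →
      ∃ (B : ℕ) (A : DistAlgorithm (Fin k)),
        (∀ n : ℕ, A.rounds n ≤ C * (logStar n + 1)) ∧
        ∀ (V : Type) [Fintype V] (N : Network V),
          (∀ v : V, N.ident v < Fintype.card V ^ c) →
            A.MessagesBoundedBy N (B * (Nat.log 2 (Fintype.card V) + 1)) ∧
            (1 - 1 / (k : ℝ) - ε) * maxKCut N.graph N.weight k
              ≤ cutWeight N.graph N.weight (A.result N) := by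
  obtain ⟨K, hK0, hKε, hK, hlen⟩ := exists_final_colorLength ε hε c
  refine ⟨2 + 2 ^ K, fun k hk => ?_⟩
  have : NeZero k := ⟨by omega⟩
  refine ⟨c + k, cutAlgorithm K c k, fun n => ?_, fun V _ N hid =>
    ⟨messagesBoundedBy_cutAlgorithm k hid hK, ?_⟩⟩
  · change 2 * logStar n + 2 ^ K ≤ _
    nlinarith [Nat.zero_le (2 ^ K * logStar n)]
  · rcases le_total 0 (1 - 1 / (k : ℝ) - ε) with h | h
    · have h1 := le_cutWeight_cutAlgorithm k hid hK0 hK (hlen _)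
      have h2 := mul_le_mul_of_nonneg_left (N.two_mul_maxKCut_le k) h
      have h3 : (1 - 1 / (k : ℝ) - ε) * ∑ v, N.weightedDegree v ≤
          (1 - 1 / (k : ℝ) - 2 / K) * ∑ v, N.weightedDegree v :=
        mul_le_mul_of_nonneg_right (by linarith)
          (Finset.sum_nonneg fun v _ => N.weightedDegree_nonneg v)
      linarith
    -- If the ratio is not positive, any cut will do.
    · exact (mul_nonpos_of_nonpos_of_nonneg h (N.maxKCut_nonneg k)).trans
        (N.cutWeight_nonneg _)
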